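/- Let $m,n\ge 4$ be integers and let $a\in\mathbb{R}$ satisfy $a=3$ or $a>5$. Let $\{e_i\}_{i=0}^{m-1}$ and $\{f_j\}_{j=0}^{n-1}$ be the canonical bases of $\mathbb{C}^m$ and $\mathbb{C}^n$. The Schmidt rank of a vector $\psi\in\mathbb{C}^m\otimes\mathbb{C}^n$ is the minimal $k$ for which $\psi=\sum_{l=1}^{k}\alpha_l\,u_l\otimes v_l$ with real $\alpha_l>0$ and orthonormal families $(u_l)_{l=1}^k$ in $\mathbb{C}^m$ and $(v_l)_{l=1}^k$ in $\mathbb{C}^n$. For $2\le i\le m-2$ and $2\le j\le n-2$ put $$g_{i,j}=e_{i-2}\otimes f_{j+1}-a\,e_{i-1}\otimes f_j+a\,e_i\otimes f_{j-1}-e_{i+1}\otimes f_{j-2}.$$ For $0\le d\le N:=m+n-2$ let $\mathcal{S}^{(d)}$ be the complex span of the $g_{i,j}$ with $i+j=d+1$ (so $\mathcal{S}^{(d)}=\{0\}$ unless $3\le d\le N-3$), and let $\mathcal{S}$ be the complex span of all the $g_{i,j}$. Then: 1. $\mathcal{S}=\bigoplus_{d=0}^{N}\mathcal{S}^{(d)}$;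 2. $\mathcal{S}$ contains no nonzero vector of Schmidt rank $\le 3$; 3. the vectors $g_{i,j}$ form a basis of $\mathcal{S}$, and $\dim\mathcal{S}=(m-3)(n-3)$; 4. this dimension is maximal: every subspace of $\mathbb{C}^m\otimes\mathbb{C}^n$ that contains no nonzero vector of Schmidt rank $\le 3$ has dimension at most $(m-3)(n-3)$; 5. each $g_{i,j}$ has Schmidt rank exactly $4$. -/

import Mathlib

open scoped TensorProduct

noncomputable section

namespace SchmidtSubspace

/-- The bipartite space `ℂ^m ⊗ ℂ^n`, each factor carrying its standard inner product. -/
abbrev Bipartite (m n : ℕ) : Type :=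
  EuclideanSpace ℂ (Fin m) ⊗[ℂ] EuclideanSpace ℂ (Fin n)

/-- `ψ` has a Schmidt decomposition with exactly `k` terms: `ψ = ∑ j, α j • (u j ⊗ v j)` with
`u`, `v` orthonormal and every `α j` positive. (For a unit vector `ψ` the `α j` then
automatically satisfy `∑ j, α j ^ 2 = 1`; the zero vector has the empty decomposition.) -/
def HasSchmidtDecomposition {m n : ℕ} (ψ : Bipartite m n) (k : ℕ) : Prop :=
  ∃ (α : Fin k → ℝ) (u : Fin k → EuclideanSpace ℂ (Fin m)) (v : Fin k → EuclideanSpace ℂ (Fin n)),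
    (∀ j, 0 < α j) ∧ Orthonormal ℂ u ∧ Orthonormal ℂ v ∧
      ψ = ∑ j, (α j : ℂ) • (u j ⊗ₜ[ℂ] v j)

/-- The Schmidt rank: the minimum number of terms in a Schmidt decomposition. The set below is
never empty, by the Schmidt decomposition theorem. -/
def schmidtRank {m n : ℕ} (ψ : Bipartite m n) : ℕ :=
  sInf {k | HasSchmidtDecomposition ψ k}

/-- The canonical basis vector of `ℂ^m` with index `k`, where `0 ≤ k ≤ m - 1`.
(The value is `0` for `k ≥ m`, which is never used.) -/
def ket (m k : ℕ) : EuclideanSpace ℂ (Fin m) :=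
  if h : k < m then EuclideanSpace.single ⟨k, h⟩ 1 else 0

/-- The vector `e_{i-2} ⊗ f_{j+1} - a e_{i-1} ⊗ f_j + a e_i ⊗ f_{j-1} - e_{i+1} ⊗ f_{j-2}`,
used for `(i, j)` in `indexSet m n` only. -/
def gen (m n : ℕ) (a : ℝ) (p : ℕ × ℕ) : Bipartite m n :=
  ket m (p.1 - 2) ⊗ₜ[ℂ] ket n (p.2 + 1)
    - (a : ℂ) • (ket m (p.1 - 1) ⊗ₜ[ℂ] ket n p.2)
    + (a : ℂ) • (ket m p.1 ⊗ₜ[ℂ] ket n (p.2 - 1))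
    - ket m (p.1 + 1) ⊗ₜ[ℂ] ket n (p.2 - 2)

/-- The pairs `(i, j)` with `2 ≤ i ≤ m - 2` and `2 ≤ j ≤ n - 2`. -/
def indexSet (m n : ℕ) : Set (ℕ × ℕ) :=
  {p | 2 ≤ p.1 ∧ p.1 + 2 ≤ m ∧ 2 ≤ p.2 ∧ p.2 + 2 ≤ n}

/-- `S^(d)`: the span of the generators with `i + j = d + 1`. There are none for `d < 3` and for
`d > m + n - 5`, so that `S^(d) = 0` then. -/
def component (m n : ℕ) (a : ℝ) (d : ℕ) : Submodule ℂ (Bipartite m n) :=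
  Submodule.span ℂ (gen m n a '' {p ∈ indexSet m n | p.1 + p.2 = d + 1})

/-- `S`: the span of all the generators. -/
def subspaceS (m n : ℕ) (a : ℝ) : Submodule ℂ (Bipartite m n) :=
  Submodule.span ℂ (gen m n a '' indexSet m n)

end SchmidtSubspace

end

/-!
The Schmidt rank of a vector is the rank of its coefficient matrix. The entries of the matrix of an
element of `S` along an antidiagonal `i + j = d` are the coefficients of a multiple of the cubic
`1 - a X + a X² - X³`, whose three roots are real and positive as soon as `3 ≤ a`; by Descartes'
rule of signs, a nonzero antidiagonal has at least four nonzero entries. Those on the lowest nonzero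
antidiagonal are the diagonal of a triangular submatrix, so the rank is at least four.

For maximality, the matrices of rank at most `r` form a closed irreducible cone of dimension at
least `m n - (m - r)(n - r)`, because the entries in `r` rows and `r` columns of such a matrix can
be prescribed generically. If a linear space `T` meets a closed cone only in `0`, then by the
Nullstellensatz the coordinate ring of the cone is finite over the algebra generated by the
`codim T` linear forms cutting out `T`, so the dimension of the cone is at most `codim T`.
-/

noncomputable section

namespace SchmidtSubspace

section SchmidtDecomposition

open scoped InnerProductSpace

/-- The coefficient matrix of a bipartite vector with respect to the canonical bases; its rank is
the Schmidt rank of the vector. -/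
def coeffMatrix (m n : ℕ) : Bipartite m n ≃ₗ[ℂ] Matrix (Fin m) (Fin n) ℂ :=
  ((EuclideanSpace.basisFun (Fin m) ℂ).toBasis.tensorProduct
    (EuclideanSpace.basisFun (Fin n) ℂ).toBasis).equivFun ≪≫ₗ
    LinearEquiv.curry ℂ ℂ (Fin m) (Fin n)

lemma coeffMatrix_tmul {m n : ℕ} (u : EuclideanSpace ℂ (Fin m)) (v : EuclideanSpace ℂ (Fin n)) :
    coeffMatrix m n (u ⊗ₜ[ℂ] v) = Matrix.vecMulVec u v := by
  ext i j
  change ((EuclideanSpace.basisFun (Fin m) ℂ).toBasis.tensorProduct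
    (EuclideanSpace.basisFun (Fin n) ℂ).toBasis).repr (u ⊗ₜ[ℂ] v) (i, j) = _
  rw [Module.Basis.tensorProduct_repr_tmul_apply]
  simp [Matrix.vecMulVec_apply, mul_comm]

lemma rank_coeffMatrix_sum_tmul_le {m n k : ℕ} (u : Fin k → EuclideanSpace ℂ (Fin m))
    (v : Fin k → EuclideanSpace ℂ (Fin n)) :
    (coeffMatrix m n (∑ j, u j ⊗ₜ[ℂ] v j)).rank ≤ k := by
  have hmul : coeffMatrix m n (∑ j, u j ⊗ₜ[ℂ] v j) =
      (Matrix.of fun i j => u j i) * (Matrix.of fun j i => v j i) := by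
    ext i l
    simp only [map_sum, coeffMatrix_tmul, Matrix.mul_apply, Matrix.sum_apply,
      Matrix.vecMulVec_apply, Matrix.of_apply]
  rw [hmul]
  exact (Matrix.rank_mul_le_left _ _).trans (Matrix.rank_le_width _)

lemma HasSchmidtDecomposition.rank_le {m n k : ℕ} {ψ : Bipartite m n}
    (h : HasSchmidtDecomposition ψ k) : (coeffMatrix m n ψ).rank ≤ k := by
  obtain ⟨α, u, v, -, -, -, rfl⟩ := h
  simp only [TensorProduct.smul_tmul']
  exact rank_coeffMatrix_sum_tmul_le _ _

lemma exists_orthonormalBasis_pairwise_inner_map_eq_zero {𝕜 E F : Type*} [RCLike 𝕜]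
    [NormedAddCommGroup E] [InnerProductSpace 𝕜 E] [FiniteDimensional 𝕜 E]
    [NormedAddCommGroup F] [InnerProductSpace 𝕜 F] [FiniteDimensional 𝕜 F] (T : E →ₗ[𝕜] F) :
    ∃ b : OrthonormalBasis (Fin (Module.finrank 𝕜 E)) 𝕜 E,
      Pairwise fun i j => ⟪T (b i), T (b j)⟫_𝕜 = 0 := by
  -- The eigenvectors of `T† T` work: `⟪T x, T y⟫ = ⟪x, T† T y⟫`.
  have hsymm := T.isSymmetric_adjoint_comp_self
  refine ⟨hsymm.eigenvectorBasis rfl, fun i j hij => ?_⟩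
  dsimp only
  rw [← LinearMap.adjoint_inner_right, ← LinearMap.comp_apply, hsymm.apply_eigenvectorBasis,
    inner_smul_right, (hsymm.eigenvectorBasis rfl).inner_eq_zero hij, mul_zero]

lemma orthonormal_norm_inv_smul {𝕜 E ι : Type*} [RCLike 𝕜] [NormedAddCommGroup E]
    [InnerProductSpace 𝕜 E] {x : ι → E} (hne : ∀ i, x i ≠ 0)
    (horth : Pairwise fun i j => ⟪x i, x j⟫_𝕜 = 0) :
    Orthonormal 𝕜 fun i => ((‖x i‖ : 𝕜)⁻¹) • x i :=
  ⟨fun i => norm_smul_inv_norm (hne i), fun i j hij => by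
    simp [inner_smul_left, inner_smul_right, horth hij]⟩

lemma orthonormal_toLp_star {𝕜 ι n : Type*} [RCLike 𝕜] [Fintype n] {v : ι → EuclideanSpace 𝕜 n}
    (hv : Orthonormal 𝕜 v) : Orthonormal 𝕜 fun i => WithLp.toLp 2 (star (v i : n → 𝕜)) := by
  classical
  rw [orthonormal_iff_ite] at hv ⊢
  intro i j
  rw [EuclideanSpace.inner_eq_star_dotProduct, dotProduct_comm]
  simpa [EuclideanSpace.inner_eq_star_dotProduct, eq_comm] using hv j i

lemma sum_vecMulVec_star_eq_one {𝕜 ι n : Type*} [RCLike 𝕜] [Fintype ι] [Fintype n] [DecidableEq n]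
    (b : OrthonormalBasis ι 𝕜 (EuclideanSpace 𝕜 n)) :
    ∑ k, Matrix.vecMulVec (b k) (star (b k : n → 𝕜)) = 1 := by
  ext i j
  have h := congrArg (· i) (b.sum_repr' (EuclideanSpace.single j 1))
  simpa [Matrix.sum_apply, Matrix.vecMulVec_apply, EuclideanSpace.inner_single_right, mul_comm,
    Matrix.one_apply, Pi.single_apply] using h

lemma hasSchmidtDecomposition_sum_tmul {m n : ℕ} {ι : Type*} [Fintype ι]
    {x : ι → EuclideanSpace ℂ (Fin m)} {v : ι → EuclideanSpace ℂ (Fin n)}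
    (hx : Pairwise fun i j => ⟪x i, x j⟫_ℂ = 0) (hv : Orthonormal ℂ v) :
    HasSchmidtDecomposition (∑ i, x i ⊗ₜ[ℂ] v i) (Nat.card {i // x i ≠ 0}) := by
  classical
  let e : Fin (Nat.card {i // x i ≠ 0}) ≃ {i // x i ≠ 0} := (Finite.equivFin _).symm
  have hinj : Function.Injective fun j => (e j : ι) := Subtype.val_injective.comp e.injective
  refine ⟨fun j => ‖x (e j)‖, fun j => ((‖x (e j)‖ : ℂ)⁻¹) • x (e j), fun j => v (e j),
    fun j => norm_pos_iff.2 (e j).2,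
    orthonormal_norm_inv_smul (fun j => (e j).2) (hx.comp_of_injective hinj),
    hv.comp _ hinj, ?_⟩
  have hterm : ∀ i : {i // x i ≠ 0}, (‖x i‖ : ℂ) • (((‖x i‖ : ℂ)⁻¹ • x i) ⊗ₜ[ℂ] v i) =
      x i ⊗ₜ[ℂ] v i := fun i => by
    rw [TensorProduct.smul_tmul', smul_inv_smul₀]
    simpa using i.2
  simp only [hterm]
  rw [e.sum_comp fun i : {i // x i ≠ 0} => x i ⊗ₜ[ℂ] v i,
    ← Finset.sum_subtype (Finset.univ.filter (x · ≠ 0)) (by simp) fun i => x i ⊗ₜ[ℂ] v i]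
  refine (Finset.sum_filter_of_ne fun i _ => mt fun hi => ?_).symm
  rw [hi, TensorProduct.zero_tmul]

lemma exists_hasSchmidtDecomposition_le_rank {m n : ℕ} (ψ : Bipartite m n) :
    ∃ k ≤ (coeffMatrix m n ψ).rank, HasSchmidtDecomposition ψ k := by
  let A := coeffMatrix m n ψ
  let T := Matrix.toEuclideanLin (𝕜 := ℂ) A
  have hrank : A.rank = Module.finrank ℂ T.range :=
    A.rank_eq_finrank_range_toLin (PiLp.basisFun 2 ℂ (Fin m)) (PiLp.basisFun 2 ℂ (Fin n))
  obtain ⟨b, hb⟩ := exists_orthonormalBasis_pairwise_inner_map_eq_zero T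
  have hψ : ψ = ∑ i, T (b i) ⊗ₜ[ℂ] WithLp.toLp 2 (star (b i : Fin n → ℂ)) := by
    apply (coeffMatrix m n).injective
    rw [map_sum]
    simp only [coeffMatrix_tmul]
    change A = ∑ i, Matrix.vecMulVec (A.mulVec (b i)) (star (b i : Fin n → ℂ))
    simp only [← Matrix.mul_vecMulVec]
    rw [← Matrix.mul_sum, sum_vecMulVec_star_eq_one, Matrix.mul_one]
  refine ⟨_, ?_, hψ ▸ hasSchmidtDecomposition_sum_tmul hb (orthonormal_toLp_star b.orthonormal)⟩
  have hli := linearIndependent_of_ne_zero_of_inner_eq_zero (ι := {i // T (b i) ≠ 0})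
    (fun i => i.2) (hb.comp_of_injective Subtype.val_injective)
  have := Fintype.ofFinite {i // T (b i) ≠ 0}
  rw [Nat.card_eq_fintype_card, ← finrank_span_eq_card hli, hrank]
  refine Submodule.finrank_mono (Submodule.span_le.2 ?_)
  rintro _ ⟨i, rfl⟩
  exact ⟨b i, rfl⟩

lemma schmidtRank_eq_rank {m n : ℕ} (ψ : Bipartite m n) :
    schmidtRank ψ = (coeffMatrix m n ψ).rank := by
  obtain ⟨k, hk, hdec⟩ := exists_hasSchmidtDecomposition_le_rank ψ
  exact le_antisymm ((Nat.sInf_le hdec).trans hk) (le_csInf ⟨k, hdec⟩ fun _ h => h.rank_le)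

end SchmidtDecomposition

section Descartes

open Polynomial

lemma signVariations_lt_card_support {R : Type*} [Ring R] [LinearOrder R] {P : R[X]} (hP : P ≠ 0) :
    P.signVariations < P.support.card := by
  induction hk : P.support.card using Nat.strong_induction_on generalizing P with
  | _ k ih =>
    subst hk
    by_cases h0 : P.eraseLead = 0
    · simp [signVariations_eq_eraseLead_add_ite hP, h0, hP]
    · have hlt := eraseLead_support_card_lt hP
      have herase := ih _ hlt h0 rfl
      have hsucc := P.signVariations_le_eraseLead_succ
      omega

lemma card_lt_card_support_of_prod_X_sub_C_dvd {R : Type*} [CommRing R]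
    [LinearOrder R] [IsStrictOrderedRing R] {s : Multiset R} (hs : ∀ x ∈ s, 0 < x) {P : R[X]}
    (hP : P ≠ 0) (hdvd : (s.map fun x => X - C x).prod ∣ P) : s.card < P.support.card :=
  calc s.card = s.countP (0 < ·) := (Multiset.countP_eq_card.2 hs).symm
    _ ≤ P.roots.countP (0 < ·) :=
      Multiset.countP_le_of_le _ ((Multiset.prod_X_sub_C_dvd_iff_le_roots hP s).1 hdvd)
    _ ≤ P.signVariations := roots_countP_pos_le_signVariations P
    _ < P.support.card := signVariations_lt_card_support hP

lemma exists_eq_map_ofReal_add_I_mul_map_ofReal (P : ℂ[X]) :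
    ∃ A B : ℝ[X], P = A.map Complex.ofRealHom + C Complex.I * B.map Complex.ofRealHom := by
  induction P using Polynomial.induction_on' with
  | add P Q hP hQ =>
    obtain ⟨A, B, rfl⟩ := hP
    obtain ⟨A', B', rfl⟩ := hQ
    exact ⟨A + A', B + B', by simp only [Polynomial.map_add]; ring⟩
  | monomial k z =>
    refine ⟨monomial k z.re, monomial k z.im, ?_⟩
    simp [C_mul_monomial, ← map_add, mul_comm Complex.I]

lemma support_map_ofReal_add_I_mul_map_ofReal (A B : ℝ[X]) :
    (A.map Complex.ofRealHom + C Complex.I * B.map Complex.ofRealHom).support =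
      A.support ∪ B.support := by
  ext k
  simp [Complex.ext_iff, or_iff_not_imp_left]

lemma card_lt_card_support_of_prod_X_sub_C_ofReal_dvd {s : Multiset ℝ} (hs : ∀ x ∈ s, 0 < x)
    {P : ℂ[X]} (hP : P ≠ 0) (hdvd : (s.map fun x : ℝ => X - C (x : ℂ)).prod ∣ P) :
    s.card < P.support.card := by
  let D : ℝ[X] := (s.map fun x => X - C x).prod
  have hD : (s.map fun x : ℝ => X - C (x : ℂ)).prod = D.map Complex.ofRealHom := by
    simp [D, Polynomial.map_multiset_prod]
  have hD0 : D ≠ 0 := (monic_multisetProd_X_sub_C s).ne_zero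
  obtain ⟨Q, rfl⟩ := hdvd
  obtain ⟨A, B, rfl⟩ := exists_eq_map_ofReal_add_I_mul_map_ofReal Q
  have hsplit : (s.map fun x : ℝ => X - C (x : ℂ)).prod *
      (A.map Complex.ofRealHom + C Complex.I * B.map Complex.ofRealHom) =
      (D * A).map Complex.ofRealHom + C Complex.I * (D * B).map Complex.ofRealHom := by
    rw [hD, Polynomial.map_mul, Polynomial.map_mul]
    ring
  rw [hsplit, support_map_ofReal_add_I_mul_map_ofReal]
  by_cases hA : A = 0
  · have hB : B ≠ 0 := by
      rintro rfl
      simp [hA] at hP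
    exact (card_lt_card_support_of_prod_X_sub_C_dvd hs (mul_ne_zero hD0 hB)
      (dvd_mul_right D B)).trans_le (Finset.card_le_card Finset.subset_union_right)
  · exact (card_lt_card_support_of_prod_X_sub_C_dvd hs (mul_ne_zero hD0 hA)
      (dvd_mul_right D A)).trans_le (Finset.card_le_card Finset.subset_union_left)

/-- The antipalindromic cubic `1 - a X + a X² - X³`, whose coefficients are those of the
generators `gen m n a p`. -/
def cubic (a : ℝ) : ℂ[X] := 1 - C (a : ℂ) * X + C (a : ℂ) * X ^ 2 - X ^ 3

lemma cubic_ne_zero (a : ℝ) : cubic a ≠ 0 := by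
  intro h
  simpa [cubic] using congrArg (eval 0) h

lemma exists_pos_prod_X_sub_C_dvd_cubic {a : ℝ} (ha : 3 ≤ a) :
    ∃ s : Multiset ℝ, s.card = 3 ∧ (∀ x ∈ s, 0 < x) ∧
      (s.map fun x : ℝ => X - C (x : ℂ)).prod ∣ cubic a := by
  -- `cubic a = -(X - 1) (X ^ 2 - (a - 1) X + 1)`, and the discriminant is `(a - 1) ^ 2 - 4`.
  have hdisc : 0 ≤ (a - 1) ^ 2 - 4 := by nlinarith
  set t := √((a - 1) ^ 2 - 4)
  have hsq : t ^ 2 = (a - 1) ^ 2 - 4 := Real.sq_sqrt hdisc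
  have ht0 : 0 ≤ t := Real.sqrt_nonneg _
  have hlt : t < a - 1 := lt_of_pow_lt_pow_left₀ 2 (by linarith) (by linarith)
  refine ⟨{1, (a - 1 + t) / 2, (a - 1 - t) / 2}, rfl, ?_, ?_⟩
  · simp only [Multiset.insert_eq_cons, Multiset.mem_cons, Multiset.mem_singleton]
    rintro x (rfl | rfl | rfl) <;> linarith
  have hsum : C (((a - 1 + t) / 2 : ℝ) : ℂ) + C (((a - 1 - t) / 2 : ℝ) : ℂ) = C (a : ℂ) - 1 := by
    rw [← C_add, ← C_1, ← C_sub, ← Complex.ofReal_add]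
    congr 1
    push_cast
    ring
  have hprod : C (((a - 1 + t) / 2 : ℝ) : ℂ) * C (((a - 1 - t) / 2 : ℝ) : ℂ) = 1 := by
    rw [← C_mul, ← C_1, ← Complex.ofReal_mul, ← Complex.ofReal_one]
    congr 2
    nlinarith
  refine ⟨-1, ?_⟩
  simp only [Multiset.insert_eq_cons, Multiset.map_cons, Multiset.map_singleton,
    Multiset.prod_cons, Multiset.prod_singleton, Complex.ofReal_one, C_1, cubic]
  linear_combination (-X ^ 2 + X) * hsum + (X - 1) * hprod

lemma three_lt_card_support_of_cubic_dvd {a : ℝ} (ha : 3 ≤ a) {P : ℂ[X]} (hP : P ≠ 0)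
    (hdvd : cubic a ∣ P) : 3 < P.support.card := by
  obtain ⟨s, hcard, hs, hsdvd⟩ := exists_pos_prod_X_sub_C_dvd_cubic ha
  exact hcard ▸ card_lt_card_support_of_prod_X_sub_C_ofReal_dvd hs hP (hsdvd.trans hdvd)

end Descartes

section Antidiagonal

open Polynomial

/-- The generating polynomial `∑ M i j T^(i + j) X^i` of a matrix: the coefficient of `T^d` is the
generating polynomial in `X` of the antidiagonal `i + j = d`. -/
def antidiagonalPolynomial (R : Type*) [CommSemiring R] (m n : ℕ) :
    Matrix (Fin m) (Fin n) R →ₗ[R] R[X][X] where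
  toFun M := ∑ i : Fin m, ∑ j : Fin n, monomial (i + j : ℕ) (monomial (i : ℕ) (M i j))
  map_add' M N := by simp only [Matrix.add_apply, map_add, Finset.sum_add_distrib]
  map_smul' c M := by
    simp only [Matrix.smul_apply, ← smul_monomial, Finset.smul_sum, RingHom.id_apply]

section CommSemiring

variable {R : Type*} [CommSemiring R] {m n : ℕ}

lemma antidiagonalPolynomial_apply (M : Matrix (Fin m) (Fin n) R) :
    antidiagonalPolynomial R m n M =
      ∑ i : Fin m, ∑ j : Fin n, monomial (i + j : ℕ) (monomial (i : ℕ) (M i j)) := rfl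

lemma antidiagonalPolynomial_single (i : Fin m) (j : Fin n) (c : R) :
    antidiagonalPolynomial R m n (Matrix.single i j c) =
      monomial (i + j : ℕ) (monomial (i : ℕ) c) := by
  rw [antidiagonalPolynomial_apply, Fintype.sum_eq_single i, Fintype.sum_eq_single j]
  · simp
  · intro j' hj
    simp [hj.symm]
  · intro i' hi
    simp [hi.symm]

lemma coeff_coeff_antidiagonalPolynomial (M : Matrix (Fin m) (Fin n) R) (d k : ℕ) :
    ((antidiagonalPolynomial R m n M).coeff d).coeff k =
      ∑ i : Fin m, ∑ j : Fin n, if (i + j : ℕ) = d ∧ (i : ℕ) = k then M i j else 0 := by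
  simp only [antidiagonalPolynomial_apply, finsetSum_coeff, coeff_monomial]
  refine Finset.sum_congr rfl fun i _ => Finset.sum_congr rfl fun j _ => ?_
  by_cases hd : (i + j : ℕ) = d <;> simp [hd, coeff_monomial]

lemma coeff_add_coeff_antidiagonalPolynomial (M : Matrix (Fin m) (Fin n) R) (i : Fin m)
    (j : Fin n) : ((antidiagonalPolynomial R m n M).coeff (i + j)).coeff i = M i j := by
  rw [coeff_coeff_antidiagonalPolynomial, Fintype.sum_eq_single i, Fintype.sum_eq_single j]
  · simp
  · intro j' hj
    simp [Fin.val_inj, hj]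
  · intro i' hi
    simp [Fin.val_inj, hi]

lemma antidiagonalPolynomial_injective :
    Function.Injective (antidiagonalPolynomial R m n) := fun M N h => by
  ext i j
  rw [← coeff_add_coeff_antidiagonalPolynomial M, h, coeff_add_coeff_antidiagonalPolynomial]

lemma exists_of_mem_support_coeff_antidiagonalPolynomial {M : Matrix (Fin m) (Fin n) R} {d k : ℕ}
    (h : k ∈ ((antidiagonalPolynomial R m n M).coeff d).support) :
    ∃ (i : Fin m) (j : Fin n), (i : ℕ) = k ∧ (i + j : ℕ) = d := by
  rw [mem_support_iff, coeff_coeff_antidiagonalPolynomial] at h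
  obtain ⟨i, -, hi⟩ := Finset.exists_ne_zero_of_sum_ne_zero h
  obtain ⟨j, -, hj⟩ := Finset.exists_ne_zero_of_sum_ne_zero hi
  obtain ⟨hd, hk⟩ : (i + j : ℕ) = d ∧ (i : ℕ) = k := by
    by_contra hne
    exact hj (if_neg hne)
  exact ⟨i, j, hk, hd⟩

end CommSemiring

lemma card_support_trailingCoeff_antidiagonalPolynomial_le_rank {R : Type*} [CommRing R]
    [IsDomain R] {m n : ℕ} (M : Matrix (Fin m) (Fin n) R) :
    (antidiagonalPolynomial R m n M).trailingCoeff.support.card ≤ M.rank := by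
  -- The rows and columns meeting the lowest nonzero antidiagonal in its nonzero entries give a
  -- triangular submatrix with these entries on the diagonal.
  set d := (antidiagonalPolynomial R m n M).natTrailingDegree
  have hlow : ∀ (i : Fin m) (j : Fin n), (i + j : ℕ) < d → M i j = 0 := fun i j hij => by
    rw [← coeff_add_coeff_antidiagonalPolynomial M i j,
      coeff_eq_zero_of_lt_natTrailingDegree hij, coeff_zero]
  change ((antidiagonalPolynomial R m n M).coeff d).support.card ≤ M.rank
  choose row col hrow hcol using
    fun k : ((antidiagonalPolynomial R m n M).coeff d).support =>
      exists_of_mem_support_coeff_antidiagonalPolynomial k.2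
  have hdet : (M.submatrix row col).det ≠ 0 := by
    rw [Matrix.det_of_isLowerTriangular]
    · refine Finset.prod_ne_zero_iff.2 fun k _ => ?_
      rw [Matrix.submatrix_apply, ← coeff_add_coeff_antidiagonalPolynomial M, hcol, hrow]
      exact mem_support_iff.1 k.2
    · intro k l hkl
      have hkl : (k : ℕ) < l := hkl
      refine hlow _ _ ?_
      rw [← hcol l, hrow, hrow]
      omega
  calc _ = (M.submatrix row col).rank := by
        rw [Matrix.rank_of_det_ne_zero hdet, Fintype.card_coe]
    _ ≤ M.rank := Matrix.rank_submatrix_le M row col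

end Antidiagonal

section Generators

open Polynomial

variable {m n : ℕ} {a : ℝ}

lemma coeffMatrix_ket_tmul_ket {r s : ℕ} (hr : r < m) (hs : s < n) :
    coeffMatrix m n (ket m r ⊗ₜ[ℂ] ket n s) = Matrix.single ⟨r, hr⟩ ⟨s, hs⟩ 1 := by
  rw [coeffMatrix_tmul, Matrix.single_eq_single_vecMulVec_single]
  simp [ket, hr, hs]

lemma antidiagonalPolynomial_coeffMatrix_gen (a : ℝ) {p : ℕ × ℕ} (hp : p ∈ indexSet m n) :
    antidiagonalPolynomial ℂ m n (coeffMatrix m n (gen m n a p)) =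
      C (cubic a) * monomial (p.1 + p.2 - 1) (X ^ (p.1 - 2)) := by
  obtain ⟨i, j⟩ := p
  obtain ⟨hi, him, hj, hjn⟩ := hp
  dsimp only at hi him hj hjn
  obtain ⟨k, rfl⟩ := Nat.exists_eq_add_of_le' hi
  obtain ⟨l, rfl⟩ := Nat.exists_eq_add_of_le' hj
  simp only [gen, map_sub, map_add, map_smul]
  rw [coeffMatrix_ket_tmul_ket (r := k + 2 - 2) (by omega) (by omega),
    coeffMatrix_ket_tmul_ket (r := k + 2 - 1) (by omega) (by omega),
    coeffMatrix_ket_tmul_ket (r := k + 2) (by omega) (by omega),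
    coeffMatrix_ket_tmul_ket (r := k + 2 + 1) (by omega) (by omega)]
  simp only [antidiagonalPolynomial_single, C_mul_monomial, smul_monomial]
  rw [show k + 2 - 2 + (l + 2 + 1) = k + 2 + (l + 2) - 1 by omega,
    show k + 2 - 1 + (l + 2) = k + 2 + (l + 2) - 1 by omega,
    show k + 2 + (l + 2 - 1) = k + 2 + (l + 2) - 1 by omega,
    show k + 2 + 1 + (l + 2 - 2) = k + 2 + (l + 2) - 1 by omega, ← map_sub, ← map_add, ← map_sub]
  congr 1
  simp only [← C_mul_X_pow_eq_monomial, cubic, Nat.add_sub_cancel, show k + 2 - 1 = k + 1 by omega]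
  simp only [map_one, one_mul, smul_eq_mul, mul_one]
  ring

lemma cubic_dvd_coeff_antidiagonalPolynomial {ψ : Bipartite m n} (hψ : ψ ∈ subspaceS m n a)
    (d : ℕ) : cubic a ∣ (antidiagonalPolynomial ℂ m n (coeffMatrix m n ψ)).coeff d := by
  revert d
  rw [← C_dvd_iff_dvd_coeff]
  induction hψ using Submodule.span_induction with
  | mem ψ hψ =>
    obtain ⟨p, hp, rfl⟩ := hψ
    exact ⟨_, antidiagonalPolynomial_coeffMatrix_gen a hp⟩
  | zero => simp
  | add ψ φ _ _ hψ hφ => simpa only [map_add] using dvd_add hψ hφ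
  | smul c ψ _ hψ => simpa only [map_smul] using dvd_smul_of_dvd c hψ

lemma three_lt_schmidtRank_of_mem_subspaceS (ha : 3 ≤ a) {ψ : Bipartite m n}
    (hψ : ψ ∈ subspaceS m n a) (h0 : ψ ≠ 0) : 3 < schmidtRank ψ := by
  rw [schmidtRank_eq_rank]
  refine (three_lt_card_support_of_cubic_dvd ha ?_
    (cubic_dvd_coeff_antidiagonalPolynomial hψ _)).trans_le
    (card_support_trailingCoeff_antidiagonalPolynomial_le_rank _)
  rw [← trailingCoeff, trailingCoeff_nonzero_iff_nonzero,
    map_ne_zero_iff _ antidiagonalPolynomial_injective]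
  simpa using h0

lemma linearIndependent_gen (m n : ℕ) (a : ℝ) :
    LinearIndependent ℂ fun p : indexSet m n => gen m n a p := by
  let φ : Bipartite m n →ₗ[ℂ] ℂ[X][X] :=
    antidiagonalPolynomial ℂ m n ∘ₗ (coeffMatrix m n).toLinearMap
  let index : indexSet m n → ℕ × ℕ := fun p => (p.1.1 - 2, p.1.1 + p.1.2 - 1)
  have hindex : Function.Injective index := by
    intro p q h
    obtain ⟨hp₁, -, hp₂, -⟩ := p.2
    obtain ⟨hq₁, -, hq₂, -⟩ := q.2
    simp only [index, Prod.mk.injEq] at h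
    exact Subtype.ext (Prod.ext (by omega) (by omega))
  have hmonomials :=
    ((basisMonomials ℂ).smulTower (basisMonomials ℂ[X])).linearIndependent.comp index hindex
  have hmul := hmonomials.map' (LinearMap.mulLeft ℂ (C (cubic a)))
    (LinearMap.ker_eq_bot.2 (mul_right_injective₀ (C_ne_zero.2 (cubic_ne_zero a))))
  refine LinearIndependent.of_comp φ ?_
  have hφ : φ ∘ (fun p : indexSet m n => gen m n a p) = LinearMap.mulLeft ℂ (C (cubic a)) ∘
      ((basisMonomials ℂ).smulTower (basisMonomials ℂ[X])) ∘ index := by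
    ext1 p
    simp [φ, index, antidiagonalPolynomial_coeffMatrix_gen a p.2, Module.Basis.smulTower_apply,
      smul_monomial, X_pow_eq_monomial]
  rw [hφ]
  exact hmul

lemma schmidtRank_gen_le_four (p : ℕ × ℕ) : schmidtRank (gen m n a p) ≤ 4 := by
  have hsum : gen m n a p = ∑ k : Fin 4,
      (![ket m (p.1 - 2), -((a : ℂ) • ket m (p.1 - 1)), (a : ℂ) • ket m p.1,
        -ket m (p.1 + 1)] k) ⊗ₜ[ℂ]
      (![ket n (p.2 + 1), ket n p.2, ket n (p.2 - 1), ket n (p.2 - 2)] k) := by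
    simp [Fin.sum_univ_four, gen, TensorProduct.neg_tmul, TensorProduct.smul_tmul',
      sub_eq_add_neg]
  rw [schmidtRank_eq_rank, hsum]
  exact rank_coeffMatrix_sum_tmul_le _ _

lemma schmidtRank_gen (ha : 3 ≤ a) {p : ℕ × ℕ} (hp : p ∈ indexSet m n) :
    schmidtRank (gen m n a p) = 4 := by
  have hmem : gen m n a p ∈ subspaceS m n a := Submodule.subset_span (Set.mem_image_of_mem _ hp)
  have h0 : gen m n a p ≠ 0 := by
    simpa only using (linearIndependent_gen m n a).ne_zero ⟨p, hp⟩
  exact le_antisymm (schmidtRank_gen_le_four p) (three_lt_schmidtRank_of_mem_subspaceS ha hmem h0)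

lemma finrank_subspaceS (m n : ℕ) (a : ℝ) :
    Module.finrank ℂ (subspaceS m n a) = (m - 3) * (n - 3) := by
  let s : Finset (ℕ × ℕ) := Finset.Icc 2 (m - 2) ×ˢ Finset.Icc 2 (n - 2)
  have hs : ∀ p, p ∈ s ↔ p ∈ indexSet m n := fun p => by
    simp only [s, Finset.mem_product, Finset.mem_Icc, indexSet, Set.mem_ofPred_eq]
    omega
  let _ : Fintype (indexSet m n) := Fintype.ofFinset s hs
  rw [subspaceS, Set.image_eq_range, finrank_span_eq_card (linearIndependent_gen m n a),
    Fintype.card_ofFinset, Finset.card_product, Nat.card_Icc, Nat.card_Icc]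
  rfl

lemma subspaceS_eq_iSup_component (m n : ℕ) (a : ℝ) :
    subspaceS m n a = ⨆ d : Fin (m + n - 1), component m n a d := by
  apply le_antisymm
  · refine Submodule.span_le.2 ?_
    rintro _ ⟨p, hp, rfl⟩
    obtain ⟨hi, him, hj, hjn⟩ := id hp
    refine Submodule.mem_iSup_of_mem ⟨p.1 + p.2 - 1, by omega⟩
      (Submodule.subset_span ⟨p, ⟨hp, ?_⟩, rfl⟩)
    dsimp only
    omega
  · exact iSup_le fun d => Submodule.span_mono (Set.image_mono fun p hp => hp.1)

lemma disjoint_span_gen_image (m n : ℕ) (a : ℝ) {s t : Set (ℕ × ℕ)} (hst : Disjoint s t) :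
    Disjoint (Submodule.span ℂ (gen m n a '' (indexSet m n ∩ s)))
      (Submodule.span ℂ (gen m n a '' (indexSet m n ∩ t))) := by
  have h := (linearIndependent_gen m n a).disjoint_span_image
    (hst.preimage (Subtype.val : indexSet m n → ℕ × ℕ))
  simpa only [Subtype.image_preimage_coe, ← Set.image_image (gen m n a) Subtype.val] using h

lemma iSupIndep_component (m n : ℕ) (a : ℝ) :
    iSupIndep fun d : Fin (m + n - 1) => component m n a d := by
  intro d
  have hle : ⨆ (d' : Fin (m + n - 1)) (_ : d' ≠ d), component m n a d' ≤
      Submodule.span ℂ (gen m n a '' (indexSet m n ∩ {p | p.1 + p.2 = d + 1}ᶜ)) := by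
    refine iSup₂_le fun d' hd' => Submodule.span_mono (Set.image_mono fun p hp => ⟨hp.1, ?_⟩)
    simp only [Set.mem_compl_iff, Set.mem_ofPred_eq, hp.2]
    exact fun h => hd' (Fin.ext (by omega))
  exact (disjoint_span_gen_image m n a disjoint_compl_right).mono_right hle

end Generators

section LinearSections

open MvPolynomial

attribute [local instance] gradedAlgebra

variable {σ ι : Type*}

lemma homogeneousComponent_add_mul {R : Type*} [CommSemiring R] {k : ℕ} {l : MvPolynomial σ R}
    (hl : l.IsHomogeneous k) (g : MvPolynomial σ R) (d : ℕ) :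
    homogeneousComponent (k + d) (l * g) = l * homogeneousComponent d g := by
  simp_rw [← decomposition.decompose'_apply]
  exact DirectSum.coe_decompose_mul_add_of_left_mem (homogeneousSubmodule σ R) hl

section CommRing

variable {R A : Type*} [CommRing R] [CommRing A] [Algebra R A] {f : MvPolynomial σ R →ₐ[R] A}
  {I : Ideal (MvPolynomial σ R)} {l : ι → MvPolynomial σ R}

lemma exists_isHomogeneous_sub_sum_mul_mem [Fintype ι]
    (hI : I.IsHomogeneous (homogeneousSubmodule σ R)) {k : ℕ} (hl : ∀ s, (l s).IsHomogeneous k)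
    {g : MvPolynomial σ R} {d : ℕ} (hg : g.IsHomogeneous (k + d))
    (hmem : g ∈ I ⊔ Ideal.span (Set.range l)) :
    ∃ b : ι → MvPolynomial σ R, (∀ s, (b s).IsHomogeneous d) ∧ g - ∑ s, l s * b s ∈ I := by
  obtain ⟨y, hy, z, hz, rfl⟩ := Submodule.mem_sup.1 hmem
  obtain ⟨c, rfl⟩ := Ideal.mem_span_range_iff_exists_fun.1 hz
  refine ⟨fun s => homogeneousComponent d (c s),
    fun s => homogeneousComponent_isHomogeneous d _, ?_⟩
  have hcomp := homogeneousComponent_eq_self hg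
  simp only [mul_comm (c _)] at hcomp ⊢
  rw [map_add, map_sum] at hcomp
  simp only [homogeneousComponent_add_mul (hl _)] at hcomp
  rw [← hcomp, add_sub_cancel_right]
  exact homogeneousComponent_mem_of_mem hI hy (k + d)

lemma map_mem_span_image_restrictTotalDegree [Finite ι]
    (hI : I.IsHomogeneous (homogeneousSubmodule σ R)) (hIf : I ≤ RingHom.ker f)
    (hl : ∀ s, (l s).IsHomogeneous 1) {N : ℕ}
    (hN : idealOfVars σ R ^ N ≤ I ⊔ Ideal.span (Set.range l)) (g : MvPolynomial σ R) :
    f g ∈ Submodule.span (Algebra.adjoin R (Set.range (f ∘ l)))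
      (f '' (restrictTotalDegree σ R N : Set (MvPolynomial σ R))) := by
  have := Fintype.ofFinite ι
  set V := Submodule.span (Algebra.adjoin R (Set.range (f ∘ l)))
    (f '' (restrictTotalDegree σ R N : Set (MvPolynomial σ R)))
  suffices hhom : ∀ d, ∀ g : MvPolynomial σ R, g.IsHomogeneous d → f g ∈ V by
    rw [← sum_homogeneousComponent g, map_sum]
    exact Submodule.sum_mem _ fun d _ => hhom d _ (homogeneousComponent_isHomogeneous d g)
  -- Modulo `I ≤ ker f`, a form of degree `> N` is a combination of the `l s` with coefficients of
  -- smaller degree.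
  intro d
  induction d with
  | zero =>
    intro g hg
    refine Submodule.subset_span ⟨g, ?_, rfl⟩
    exact (mem_restrictTotalDegree ..).2 (hg.totalDegree_le.trans N.zero_le)
  | succ d ih =>
    intro g hg
    rcases le_or_gt (d + 1) N with hd | hd
    · refine Submodule.subset_span ⟨g, ?_, rfl⟩
      exact (mem_restrictTotalDegree ..).2 (hg.totalDegree_le.trans hd)
    have hmem : g ∈ idealOfVars σ R ^ N :=
      (mem_pow_idealOfVars_iff' N g).2 fun x hx => hg.coeff_eq_zero (by omega)
    rw [add_comm] at hg
    obtain ⟨b, hb, hgb⟩ := exists_isHomogeneous_sub_sum_mul_mem hI hl hg (hN hmem)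
    have hfg : f g = ∑ s, f (l s) * f (b s) := by
      simpa only [RingHom.mem_ker, map_sub, map_sum, map_mul, sub_eq_zero] using hIf hgb
    rw [hfg]
    refine Submodule.sum_mem _ fun s _ => ?_
    exact V.smul_mem ⟨f (l s), Algebra.subset_adjoin ⟨s, rfl⟩⟩ (ih _ (hb s))

lemma finite_adjoin_of_pow_idealOfVars_le [Finite σ] [Finite ι] (hf : Function.Surjective f)
    (hI : I.IsHomogeneous (homogeneousSubmodule σ R)) (hIf : I ≤ RingHom.ker f)
    (hl : ∀ s, (l s).IsHomogeneous 1) {N : ℕ}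
    (hN : idealOfVars σ R ^ N ≤ I ⊔ Ideal.span (Set.range l)) :
    Module.Finite (Algebra.adjoin R (Set.range (f ∘ l))) A := by
  have hfg : (restrictTotalDegree σ R N).FG := Module.Finite.iff_fg.1 inferInstance
  obtain ⟨t, ht⟩ := hfg.map f.toLinearMap
  refine ⟨t, eq_top_iff.2 fun y _ => ?_⟩
  obtain ⟨g, rfl⟩ := hf y
  have hspan := map_mem_span_image_restrictTotalDegree hI hIf hl hN g
  have himage : f '' (restrictTotalDegree σ R N : Set (MvPolynomial σ R)) =
      (Submodule.span R (t : Set A) : Set A) := by rw [ht]; rfl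
  rwa [himage, Submodule.span_span_of_tower] at hspan

end CommRing

section IsAlgClosed

variable {K A : Type*} [Field K] [IsAlgClosed K] [CommRing A] [Algebra K A]
  {f : MvPolynomial σ K →ₐ[K] A} {I : Ideal (MvPolynomial σ K)} {l : ι → MvPolynomial σ K}

lemma exists_pow_idealOfVars_le [Finite σ] {J : Ideal (MvPolynomial σ K)}
    (hJ : ∀ x ∈ zeroLocus K J, x = 0) : ∃ N, idealOfVars σ K ^ N ≤ J := by
  refine Ideal.exists_pow_le_of_le_radical_of_fg ?_ (idealOfVars_fg σ K)
  rw [idealOfVars, Ideal.span_le]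
  rintro _ ⟨i, rfl⟩
  rw [SetLike.mem_coe, ← vanishingIdeal_zeroLocus_eq_radical (K := K), mem_vanishingIdeal_iff]
  intro x hx
  simp [hJ x hx]

lemma trdeg_le_card_of_forall_zero [Finite σ] [Fintype ι] [IsDomain A]
    (hf : Function.Surjective f) (hI : I.IsHomogeneous (homogeneousSubmodule σ K))
    (hIf : I ≤ RingHom.ker f) (hl : ∀ s, (l s).IsHomogeneous 1)
    (hzero : ∀ x ∈ zeroLocus K I, (∀ s, eval x (l s) = 0) → x = 0) :
    Algebra.trdeg K A ≤ Fintype.card ι := by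
  obtain ⟨N, hN⟩ := exists_pow_idealOfVars_le (J := I ⊔ Ideal.span (Set.range l)) fun x hx =>
    hzero x (zeroLocus_anti_mono le_sup_left hx) fun s => by
      simpa [aeval_eq_eval] using
        hx (l s) (Ideal.mem_sup_right (Ideal.subset_span (Set.mem_range_self s)))
  have := finite_adjoin_of_pow_idealOfVars_le hf hI hIf hl hN
  have : Algebra.IsAlgebraic (Algebra.adjoin K (Set.range (f ∘ l))) A := inferInstance
  refine (Algebra.IsAlgebraic.trdeg_le_cardinalMk K (Set.range (f ∘ l))).trans ?_
  simpa using Cardinal.mk_range_le_lift (f := f ∘ l)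

lemma trdeg_add_finrank_le [Fintype σ] [IsDomain A]
    (hf : Function.Surjective f) (hI : I.IsHomogeneous (homogeneousSubmodule σ K))
    (hIf : I ≤ RingHom.ker f) {T : Submodule K (σ → K)} (hT : ∀ x ∈ T, x ∈ zeroLocus K I → x = 0) :
    Algebra.trdeg K A + Module.finrank K T ≤ Fintype.card σ := by
  classical
  let e := (Module.finBasis K ((σ → K) ⧸ T)).equivFun
  let M := LinearMap.toMatrix' (e.toLinearMap ∘ₗ T.mkQ)
  have hM : ∀ x, (∀ s, eval x (M.toMvPolynomial s) = 0) → x ∈ T := fun x hx => by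
    have hMx : M.mulVec x = 0 := funext fun s => by
      rw [← Matrix.toMvPolynomial_eval_eq_apply, hx, Pi.zero_apply]
    rw [LinearMap.toMatrix'_mulVec] at hMx
    exact (Submodule.Quotient.mk_eq_zero T).1 (e.map_eq_zero_iff.1 hMx)
  have htrdeg := trdeg_le_card_of_forall_zero hf hI hIf M.toMvPolynomial_isHomogeneous
    fun x hx hMx => hT x (hM x hMx) hx
  have hcodim : Module.finrank K ((σ → K) ⧸ T) + Module.finrank K T = Fintype.card σ := by
    rw [Submodule.finrank_quotient_add_finrank, Module.finrank_fintype_fun_eq_card]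
  rw [Fintype.card_fin] at htrdeg
  rw [← hcodim]
  push_cast
  gcongr

end IsAlgClosed

end LinearSections

section MatrixRank

variable {K m n : Type*} [Field K] {k : ℕ}

lemma exists_rank_submatrix_id_eq [Finite m] [Fintype n] {A : Matrix m n K} (hk : k ≤ A.rank) :
    ∃ g : Fin k → m, (A.submatrix g id).rank = k := by
  have := Fintype.ofFinite m
  rw [Matrix.rank_eq_finrank_span_row] at hk
  obtain ⟨f, hf, -, hli⟩ := Submodule.exists_fun_fin_finrank_span_eq K (Set.range A.row)
  choose g hg using hf
  refine ⟨g ∘ Fin.castLE hk, ?_⟩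
  have hrow : (A.submatrix (g ∘ Fin.castLE hk) id).row = f ∘ Fin.castLE hk :=
    funext fun i => hg _
  have hli' : LinearIndependent K (A.submatrix (g ∘ Fin.castLE hk) id).row :=
    hrow ▸ hli.comp _ (Fin.castLE_injective hk)
  rw [hli'.rank_matrix, Fintype.card_fin]

lemma exists_det_submatrix_ne_zero [Finite m] [Fintype n] {A : Matrix m n K} (hk : k ≤ A.rank) :
    ∃ (g : Fin k → m) (h : Fin k → n), (A.submatrix g h).det ≠ 0 := by
  obtain ⟨g, hg⟩ := exists_rank_submatrix_id_eq hk
  obtain ⟨h, hh⟩ := exists_rank_submatrix_id_eq (A := (A.submatrix g id).transpose)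
    (by rw [Matrix.rank_transpose, hg])
  refine ⟨g, h, fun h0 => ?_⟩
  have hrank : (A.submatrix g h).rank = Fintype.card (Fin k) := by
    rw [Fintype.card_fin, ← Matrix.rank_transpose]
    exact hh
  have hli : LinearIndependent K (A.submatrix g h).row := by
    rw [linearIndependent_iff_card_eq_finrank_span, Set.finrank, ← Matrix.rank_eq_finrank_span_row,
      hrank]
  have hunit := Matrix.linearIndependent_rows_iff_isUnit.1 hli
  exact ((Matrix.isUnit_iff_isUnit_det _).1 hunit).ne_zero h0

end MatrixRank

section Determinantal

open MvPolynomial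

lemma algebraicIndependent_of_forall_exists_eval_eq {R σ ι : Type*} [CommRing R] [IsDomain R]
    [Infinite R] {p : ι → MvPolynomial σ R} {D : MvPolynomial ι R} (hD : D ≠ 0)
    (hp : ∀ w, eval w D ≠ 0 → ∃ x, ∀ i, eval x (p i) = w i) : AlgebraicIndependent R p := by
  rw [algebraicIndependent_iff]
  intro q hq
  refine (mul_eq_zero.1 (MvPolynomial.funext fun w => ?_ : q * D = 0)).resolve_right hD
  rw [map_mul, map_zero, mul_eq_zero]
  refine or_iff_not_imp_right.2 fun hw => ?_
  obtain ⟨x, hx⟩ := hp w hw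
  simpa only [comp_aeval_apply, aeval_eq_eval, RingHom.coe_coe, hx, map_zero] using
    congrArg (aeval x) hq

variable (R : Type*) [CommRing R] (m n : Type*) (r : ℕ)

/-- The coordinate ring of the space of pairs of an `m × r` and an `r × n` matrix. -/
abbrev FactorRing : Type _ :=
  MvPolynomial ((m × Fin r) ⊕ (Fin r × n)) R

/-- The comorphism `X i j ↦ ∑ k, U i k * V k j` of the multiplication map `(U, V) ↦ U * V`; its
range is the coordinate ring of the variety of `m × n` matrices of rank at most `r`. -/
def mulComorphism : MvPolynomial (m × n) R →ₐ[R] FactorRing R m n r :=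
  aeval fun p => ∑ k, X (Sum.inl (p.1, k)) * X (Sum.inr (k, p.2))

/-- The ideal generated by the minors of size `r + 1` of the generic `m × n` matrix. Repeated rows
and columns are allowed, as they only contribute zero minors. -/
def determinantalIdeal : Ideal (MvPolynomial (m × n) R) :=
  Ideal.span (Set.range fun s : (Fin (r + 1) → m) × (Fin (r + 1) → n) =>
    ((Matrix.mvPolynomialX m n R).submatrix s.1 s.2).det)

variable {R m n r}

lemma isHomogeneous_det {σ ι : Type*} [Fintype ι] [DecidableEq ι]
    {M : Matrix ι ι (MvPolynomial σ R)} {d : ℕ} (hM : ∀ i j, (M i j).IsHomogeneous d) :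
    M.det.IsHomogeneous (Fintype.card ι * d) := by
  rw [Matrix.det_apply]
  refine IsHomogeneous.sum _ _ _ fun τ _ => (homogeneousSubmodule σ R _).smul_of_tower_mem _ ?_
  simpa using IsHomogeneous.prod Finset.univ (fun i => M (τ i) i) (fun _ => d) fun i _ => hM _ _

attribute [local instance] gradedAlgebra

lemma isHomogeneous_determinantalIdeal :
    (determinantalIdeal R m n r).IsHomogeneous (homogeneousSubmodule (m × n) R) := by
  refine Ideal.homogeneous_span _ _ ?_
  rintro _ ⟨s, rfl⟩
  exact ⟨_, isHomogeneous_det fun i j => isHomogeneous_X R _⟩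

lemma mulComorphism_mapMatrix_mvPolynomialX :
    (Matrix.mvPolynomialX m n R).map (mulComorphism R m n r) =
      (Matrix.of fun i k => X (Sum.inl (i, k)) : Matrix m (Fin r) (FactorRing R m n r)) *
        (Matrix.of fun k j => X (Sum.inr (k, j)) : Matrix (Fin r) n (FactorRing R m n r)) := by
  ext1 i j
  simp [mulComorphism, Matrix.mul_apply]

lemma det_mul_eq_zero_of_card_lt {S ι κ : Type*} [CommRing S] [IsDomain S] [Fintype ι]
    [DecidableEq ι] [Fintype κ] (h : Fintype.card κ < Fintype.card ι)
    (U : Matrix ι κ S) (V : Matrix κ ι S) :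
    (U * V).det = 0 := by
  by_contra h0
  have hrank := (Matrix.rank_mul_le_left U V).trans U.rank_le_card_width
  rw [Matrix.rank_of_det_ne_zero h0] at hrank
  exact h.not_ge hrank

lemma determinantalIdeal_le_ker_mulComorphism [IsDomain R] :
    determinantalIdeal R m n r ≤ RingHom.ker (mulComorphism R m n r) := by
  rw [determinantalIdeal, Ideal.span_le]
  rintro _ ⟨s, rfl⟩
  rw [SetLike.mem_coe, RingHom.mem_ker, AlgHom.map_det, AlgHom.mapMatrix_apply,
    ← Matrix.submatrix_map, mulComorphism_mapMatrix_mvPolynomialX,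
    Matrix.submatrix_mul _ _ s.1 id s.2 Function.bijective_id]
  exact det_mul_eq_zero_of_card_lt (by simp) _ _

lemma rank_le_of_mem_zeroLocus_determinantalIdeal {K : Type*} [Field K] [Finite m] [Fintype n]
    {x : m × n → K} (hx : x ∈ zeroLocus K (determinantalIdeal K m n r)) :
    (Matrix.of (Function.curry x)).rank ≤ r := by
  by_contra! hlt
  obtain ⟨g, h, hdet⟩ := exists_det_submatrix_ne_zero (Nat.succ_le_of_lt hlt)
  have hx0 := hx _ (Ideal.subset_span ⟨(g, h), rfl⟩)
  rw [AlgHom.map_det] at hx0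
  refine hdet (Eq.trans ?_ hx0)
  congr 1
  ext i j
  simp

lemma submatrix_mul_inv_mul_submatrix {S ι : Type*} [CommRing S] [Fintype ι] [DecidableEq ι]
    {M : Matrix m n S} {e : ι → m} {f : ι → n} (h : IsUnit (M.submatrix e f).det) :
    (M.submatrix id f * (M.submatrix e f)⁻¹ * M.submatrix e id).submatrix e id =
        M.submatrix e id ∧
      (M.submatrix id f * (M.submatrix e f)⁻¹ * M.submatrix e id).submatrix id f =
        M.submatrix id f := by
  constructor
  · rw [Matrix.submatrix_mul _ _ e id id Function.bijective_id,
      Matrix.submatrix_mul _ _ e id id Function.bijective_id]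
    simp only [Matrix.submatrix_submatrix, Function.id_comp, Function.comp_id,
      Matrix.submatrix_id_id]
    rw [Matrix.mul_nonsing_inv _ h, Matrix.one_mul]
  · rw [Matrix.submatrix_mul _ _ id id f Function.bijective_id, Matrix.submatrix_id_id]
    simp only [Matrix.submatrix_submatrix, Function.id_comp, Function.comp_id]
    rw [Matrix.mul_assoc, Matrix.nonsing_inv_mul _ h, Matrix.mul_one]

variable {K : Type*} [Field K]

lemma exists_eval_mulComorphism_X_eq (U : Matrix m (Fin r) K) (V : Matrix (Fin r) n K) :
    ∃ x, ∀ p : m × n, eval x (mulComorphism K m n r (X p)) = (U * V) p.1 p.2 :=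
  ⟨Sum.elim (Function.uncurry U) (Function.uncurry V), fun p => by
    simp [mulComorphism, Matrix.mul_apply, Function.uncurry]⟩

/-- The index set of the entries of an `m × n` matrix lying in one of the rows `e i` or one of the
columns `f j`. -/
abbrev Cross (e : Fin r → m) (f : Fin r → n) : Type _ :=
  {p : m × n // p.1 ∈ Set.range e ∨ p.2 ∈ Set.range f}

lemma algebraicIndependent_mulComorphism_X [Infinite K] {e : Fin r → m} {f : Fin r → n}
    (he : Function.Injective e) (hf : Function.Injective f) :
    AlgebraicIndependent K fun p : Cross e f => mulComorphism K m n r (X p.1) := by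
  let c : Fin r × Fin r → Cross e f := fun p => ⟨(e p.1, f p.2), Or.inl ⟨p.1, rfl⟩⟩
  have hc : Function.Injective c := fun p q hpq =>
    Prod.ext (he (congrArg (·.1.1) hpq)) (hf (congrArg (·.1.2) hpq))
  have hD : rename c (Matrix.mvPolynomialX (Fin r) (Fin r) K).det ≠ 0 :=
    (map_ne_zero_iff _ (rename_injective c hc)).2 (Matrix.det_mvPolynomialX_ne_zero _ _)
  refine algebraicIndependent_of_forall_exists_eval_eq hD fun w hw => ?_
  let M : Matrix m n K := Matrix.of (Function.curry (Function.extend Subtype.val w 0))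
  have hM : ∀ p : Cross e f, M p.1.1 p.1.2 = w p := Subtype.val_injective.extend_apply w 0
  have hMc : M.submatrix e f =
      (eval (w ∘ c)).mapMatrix (Matrix.mvPolynomialX (Fin r) (Fin r) K) := by
    ext1 i j
    simpa using hM (c (i, j))
  have hdet : IsUnit (M.submatrix e f).det := by
    rw [eval_rename, RingHom.map_det, ← hMc] at hw
    exact hw.isUnit
  -- `M` agrees on the cross with `M(·, f) M(e, f)⁻¹ M(e, ·)`, a product of an `m × r` and an
  -- `r × n` matrix.
  obtain ⟨hrow, hcol⟩ := submatrix_mul_inv_mul_submatrix hdet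
  obtain ⟨x, hx⟩ := exists_eval_mulComorphism_X_eq
    (M.submatrix id f * (M.submatrix e f)⁻¹) (M.submatrix e id)
  refine ⟨x, ?_⟩
  rintro ⟨⟨i, j⟩, ⟨k, hk⟩ | ⟨k, hk⟩⟩
  · obtain rfl : e k = i := hk
    exact (hx _).trans ((congrFun₂ hrow k j).trans (hM ⟨(e k, j), _⟩))
  · obtain rfl : f k = j := hk
    exact (hx _).trans ((congrFun₂ hcol i k).trans (hM ⟨(i, f k), _⟩))

lemma card_cross_add [Finite m] [Finite n] {e : Fin r → m} {f : Fin r → n}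
    (he : Function.Injective e) (hf : Function.Injective f) :
    Nat.card (Cross e f) + (Nat.card m - r) * (Nat.card n - r) = Nat.card (m × n) := by
  have hcompl : {p : m × n | p.1 ∈ Set.range e ∨ p.2 ∈ Set.range f}ᶜ =
      (Set.range e)ᶜ ×ˢ (Set.range f)ᶜ := by
    ext p
    simp only [Set.mem_compl_iff, Set.mem_ofPred_eq, not_or, Set.mem_prod]
  rw [← Set.ncard_add_ncard_compl {p : m × n | p.1 ∈ Set.range e ∨ p.2 ∈ Set.range f}, hcompl,
    Set.ncard_prod, Set.ncard_compl, Set.ncard_compl, Set.ncard_range_of_injective he,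
    Set.ncard_range_of_injective hf, Nat.card_fin]
  rfl

lemma card_cross_le_trdeg_range_mulComorphism [Infinite K] [Finite m] [Finite n] {e : Fin r → m}
    {f : Fin r → n} (he : Function.Injective e) (hf : Function.Injective f) :
    (Nat.card (Cross e f) : Cardinal) ≤ Algebra.trdeg K (mulComorphism K m n r).range := by
  have hrange : AlgebraicIndependent K fun p : Cross e f =>
      (mulComorphism K m n r).rangeRestrict (X p.1) :=
    .of_comp (mulComorphism K m n r).range.val (algebraicIndependent_mulComorphism_X he hf)
  simpa only [← Nat.cast_card, Cardinal.lift_natCast, Cardinal.nat_le_lift_iff] using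
    hrange.lift_cardinalMk_le_trdeg

theorem finrank_le_of_forall_rank_le [IsAlgClosed K] [Fintype m] [Fintype n]
    (hm : r ≤ Fintype.card m) (hn : r ≤ Fintype.card n) {T : Submodule K (Matrix m n K)}
    (hT : ∀ M ∈ T, M.rank ≤ r → M = 0) :
    Module.finrank K T ≤ (Fintype.card m - r) * (Fintype.card n - r) := by
  obtain ⟨e⟩ := Function.Embedding.nonempty_of_card_le (α := Fin r) (β := m) (by simpa)
  obtain ⟨f⟩ := Function.Embedding.nonempty_of_card_le (α := Fin r) (β := n) (by simpa)
  let L : (m × n → K) ≃ₗ[K] Matrix m n K := LinearEquiv.curry K K m n ≪≫ₗ Matrix.ofLinearEquiv K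
  have hker : determinantalIdeal K m n r ≤ RingHom.ker (mulComorphism K m n r).rangeRestrict := by
    rw [AlgHom.ker_rangeRestrict]
    exact determinantalIdeal_le_ker_mulComorphism
  have hzero : ∀ x ∈ T.map L.symm.toLinearMap, x ∈ zeroLocus K (determinantalIdeal K m n r) →
      x = 0 := fun x hxT hx => by
    have hLx : L x ∈ T := by simpa using (Submodule.mem_map_equiv T).1 hxT
    exact L.map_eq_zero_iff.1 (hT _ hLx (rank_le_of_mem_zeroLocus_determinantalIdeal hx))
  have htrdeg := trdeg_add_finrank_le (mulComorphism K m n r).rangeRestrict_surjective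
    isHomogeneous_determinantalIdeal hker hzero
  rw [L.symm.finrank_map_eq] at htrdeg
  have hcross := card_cross_le_trdeg_range_mulComorphism (K := K) e.injective f.injective
  have hcard := card_cross_add e.injective f.injective
  simp only [Nat.card_eq_fintype_card (α := m), Nat.card_eq_fintype_card (α := n),
    Nat.card_eq_fintype_card (α := m × n)] at hcard
  have hsum : Nat.card (Cross e f) + Module.finrank K T ≤ Fintype.card (m × n) := by
    exact_mod_cast (add_le_add_left hcross _).trans htrdeg
  omega

end Determinantal

section DimensionBound

variable {m n r : ℕ}

theorem finrank_le_of_forall_not_schmidtRank_le (hm : r ≤ m) (hn : r ≤ n)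
    {T : Submodule ℂ (Bipartite m n)} (hT : ∀ ψ ∈ T, ψ ≠ 0 → ¬ schmidtRank ψ ≤ r) :
    Module.finrank ℂ T ≤ (m - r) * (n - r) := by
  have hrank : ∀ M ∈ T.map (coeffMatrix m n).toLinearMap, M.rank ≤ r → M = 0 := by
    rintro _ ⟨ψ, hψ, rfl⟩ hr
    by_contra h0
    exact hT ψ hψ (by rintro rfl; exact h0 (map_zero _)) ((schmidtRank_eq_rank ψ).trans_le hr)
  simpa [LinearEquiv.finrank_map_eq] using
    finrank_le_of_forall_rank_le (by simpa using hm) (by simpa using hn) hrank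

end DimensionBound

end SchmidtSubspace

end

theorem mainTheorem1_general (m n : ℕ) (hm : 3 ≤ m) (hn : 3 ≤ n) (a : ℝ) (ha : 3 ≤ a) :
    (iSupIndep (fun d : Fin (m + n - 1) => SchmidtSubspace.component m n a d) ∧
      SchmidtSubspace.subspaceS m n a =
        ⨆ d : Fin (m + n - 1), SchmidtSubspace.component m n a d) ∧
    (∀ ψ ∈ SchmidtSubspace.subspaceS m n a, ψ ≠ 0 → ¬ SchmidtSubspace.schmidtRank ψ ≤ 3) ∧
    LinearIndependent ℂ
      (fun p : SchmidtSubspace.indexSet m n => SchmidtSubspace.gen m n a p) ∧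
    Module.finrank ℂ (SchmidtSubspace.subspaceS m n a) = (m - 3) * (n - 3) ∧
    (∀ T : Submodule ℂ (SchmidtSubspace.Bipartite m n),
      (∀ ψ ∈ T, ψ ≠ 0 → ¬ SchmidtSubspace.schmidtRank ψ ≤ 3) →
        Module.finrank ℂ T ≤ (m - 3) * (n - 3)) ∧
    (∀ p ∈ SchmidtSubspace.indexSet m n,
      SchmidtSubspace.schmidtRank (SchmidtSubspace.gen m n a p) = 4) :=
  ⟨⟨SchmidtSubspace.iSupIndep_component m n a, SchmidtSubspace.subspaceS_eq_iSup_component m n a⟩,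
    fun _ hψ h0 => (SchmidtSubspace.three_lt_schmidtRank_of_mem_subspaceS ha hψ h0).not_ge,
    SchmidtSubspace.linearIndependent_gen m n a, SchmidtSubspace.finrank_subspaceS m n a,
    fun _ => SchmidtSubspace.finrank_le_of_forall_not_schmidtRank_le hm hn,
    fun _ => SchmidtSubspace.schmidtRank_gen ha⟩

theorem mainTheorem1 (m n : ℕ) (hm : 4 ≤ m) (hn : 4 ≤ n) (a : ℝ) (ha : a = 3 ∨ 5 < a) :
    -- `S` is the direct sum of the `S^(d)`, `0 ≤ d ≤ m + n - 2`
    (iSupIndep (fun d : Fin (m + n - 1) => SchmidtSubspace.component m n a d) ∧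
      SchmidtSubspace.subspaceS m n a =
        ⨆ d : Fin (m + n - 1), SchmidtSubspace.component m n a d) ∧
    -- `S` contains no nonzero vector of Schmidt rank at most `3`
    (∀ ψ ∈ SchmidtSubspace.subspaceS m n a, ψ ≠ 0 → ¬ SchmidtSubspace.schmidtRank ψ ≤ 3) ∧
    -- the generators are linearly independent, and `dim S = (m - 3)(n - 3)`
    LinearIndependent ℂ
      (fun p : SchmidtSubspace.indexSet m n => SchmidtSubspace.gen m n a p) ∧
    Module.finrank ℂ (SchmidtSubspace.subspaceS m n a) = (m - 3) * (n - 3) ∧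
    -- this is the maximal dimension of a subspace without nonzero vectors of Schmidt rank `≤ 3`
    (∀ T : Submodule ℂ (SchmidtSubspace.Bipartite m n),
      (∀ ψ ∈ T, ψ ≠ 0 → ¬ SchmidtSubspace.schmidtRank ψ ≤ 3) →
        Module.finrank ℂ T ≤ (m - 3) * (n - 3)) ∧
    -- every generator has Schmidt rank exactly `4`
    (∀ p ∈ SchmidtSubspace.indexSet m n,
      SchmidtSubspace.schmidtRank (SchmidtSubspace.gen m n a p) = 4) :=
  mainTheorem1_general m n (by lia) (by lia) a (by rcases ha with rfl | h <;> linarith)
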